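/- Let $n\ge 0$ and let $X=\{X_t\}_{t\ge 0}$ be a Lévy process on $\mathbb{R}^n$, i.e. $X_0=0$ a.s., $X$ has càdlàg paths a.s., and $X$ has stationary and independent increments. Let $(b,Q,\nu)$ be its characteristic triplet: $b\in\mathbb{R}^n$, $Q$ is a symmetric positive semidefinite $n\times n$ matrix, $\nu$ is a Borel measure on $\mathbb{R}^n$ with $\nu(\{0\})=0$ and $\int_{\mathbb{R}^n}(1\wedge\|x\|^2)\,\nu(dx)<\infty$, and $$\mathbf{E}\,e^{i\langle \xi,X_t\rangle}=e^{-t\Psi(\xi)}\qquad(t\ge 0,\ \xi\in\mathbb{R}^n),$$ where the characteristic exponent $\Psi$ is $$\Psi(\xi)=i\langle b,\xi\rangle+\tfrac12\langle \xi,Q\xi\rangle+\int_{\mathbb{R}^n}\bigl(1-e^{i\langle\xi,x\rangle}+i\langle\xi,x\rangle\mathbf{1}_{\{\|x\|\le 1\}}\bigr)\,\nu(dx).$$ Let $\beta_0\in(0,1)$ and $t>0$. Then the following are equivalent: 1. $\mathbf{E}\bigl(\|X_t\|^{\beta_0}\bigr)<\infty$; 2. $\int_{\{\|x\|>1\}}\|x\|^{\beta_0}\,\nu(dx)<\infty$;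 3. $\int_{\{\|\xi\|\le 1\}}\dfrac{\operatorname{Re}\Psi(\xi)}{\|\xi\|^{n+\beta_0}}\,d\xi<\infty$; 4. $\int_{\{\|\xi\|\le 1\}}\dfrac{|\Psi(\xi)|}{\|\xi\|^{n+\beta_0}}\,d\xi<\infty$. In particular, if $\int_{\{\|\xi\|\le 1\}}|\Psi(\xi)|\,\|\xi\|^{-n-\beta_0}\,d\xi<\infty$, then all four conditions hold. -/

import Mathlib

open MeasureTheory ProbabilityTheory Filter Topology
open scoped NNReal ENNReal

noncomputable section

/-- A path `x : [0, ∞) → E` is càdlàg: right-continuous with left limits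
(at time `0` the left limit condition is void, since `𝓝[<] 0 = ⊥` in `ℝ≥0`). -/
def IsCadlag {E : Type*} [TopologicalSpace E] (x : ℝ≥0 → E) : Prop :=
  ∀ t : ℝ≥0, ContinuousWithinAt x (Set.Ici t) t ∧ ∃ l : E, Tendsto x (𝓝[<] t) (𝓝 l)

/-- A Lévy process on `ℝⁿ`, defined on the probability space `(Ω, P)`. -/
structure IsLevyProcess {Ω : Type*} [MeasurableSpace Ω] {n : ℕ}
    (X : ℝ≥0 → Ω → EuclideanSpace ℝ (Fin n)) (P : Measure Ω) : Prop where
  measurable : ∀ t, Measurable (X t)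
  zero : ∀ᵐ ω ∂P, X 0 ω = 0
  cadlag : ∀ᵐ ω ∂P, IsCadlag fun t => X t ω
  stationary : ∀ s h : ℝ≥0,
    IdentDistrib (fun ω => X (s + h) ω - X s ω) (fun ω => X h ω - X 0 ω) P P
  indep : HasIndepIncrements X P

/-- A Lévy measure on `ℝⁿ`: no mass at the origin, and `∫ (1 ∧ ‖x‖²) ν(dx) < ∞`. -/
structure IsLevyMeasure {n : ℕ} (ν : Measure (EuclideanSpace ℝ (Fin n))) : Prop where
  zero : ν {0} = 0
  integrable : ∫⁻ x, ENNReal.ofReal (min 1 (‖x‖ ^ 2)) ∂ν < ∞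

/-- The Lévy–Khintchine exponent with drift vector `b`, Gaussian covariance matrix `Q` and Lévy
measure `ν`:
`Ψ(ξ) = i⟨b, ξ⟩ + ½⟨ξ, Qξ⟩ + ∫ (1 - exp(i⟨ξ, x⟩) + i⟨ξ, x⟩ 1_{‖x‖ ≤ 1}) ν(dx)`. -/
def levyExponent {n : ℕ} (b : EuclideanSpace ℝ (Fin n)) (Q : Matrix (Fin n) (Fin n) ℝ)
    (ν : Measure (EuclideanSpace ℝ (Fin n))) (ξ : EuclideanSpace ℝ (Fin n)) : ℂ :=
  Complex.I * (inner ℝ b ξ : ℝ)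
    + (1 / 2 : ℂ) * ((ξ.ofLp ⬝ᵥ Q.mulVec ξ.ofLp : ℝ) : ℂ)
    + ∫ x, (1 - Complex.exp (Complex.I * (inner ℝ ξ x : ℝ))
        + Set.indicator {y : EuclideanSpace ℝ (Fin n) | ‖y‖ ≤ 1}
            (fun y => Complex.I * (inner ℝ ξ y : ℝ)) x) ∂ν

/-- `(b, Q, ν)` is the characteristic triplet of the process `X`: the matrix `Q` is symmetric and
positive semidefinite, `ν` is a Lévy measure, and `E exp(i⟨ξ, X_t⟩) = exp(-t Ψ(ξ))` for all `t`
and `ξ`, where `Ψ` is the exponent of the triplet. -/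
structure IsCharacteristicTriplet {Ω : Type*} [MeasurableSpace Ω] {n : ℕ}
    (X : ℝ≥0 → Ω → EuclideanSpace ℝ (Fin n)) (P : Measure Ω)
    (b : EuclideanSpace ℝ (Fin n)) (Q : Matrix (Fin n) (Fin n) ℝ)
    (ν : Measure (EuclideanSpace ℝ (Fin n))) : Prop where
  posSemidef : Q.PosSemidef
  levyMeasure : IsLevyMeasure ν
  charFun_eq : ∀ (t : ℝ≥0) (ξ : EuclideanSpace ℝ (Fin n)),
    ∫ ω, Complex.exp (Complex.I * (inner ℝ ξ (X t ω) : ℝ)) ∂P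
      = Complex.exp (-((t : ℝ) : ℂ) * levyExponent b Q ν ξ)

end

/-!
For `0 < β < 1` the measure `m(dξ) = ‖ξ‖ ^ (-(n + β)) dξ` scales with exponent `β`, so that
`∫ min 2 (‖ξ‖ ‖x‖) m(dξ) = C ‖x‖ ^ β` with `C < ∞` and, for `‖x‖ ≥ 1`,
`∫_{‖ξ‖ ≤ 1} (1 - cos ⟨ξ, x⟩) m(dξ) ≥ c ‖x‖ ^ β` with `c > 0`. Since
`1 - cos ⟨ξ, x⟩ ≤ |1 - exp (i⟨ξ, x⟩)| ≤ min 2 (‖ξ‖ ‖x‖)`, Tonelli's theorem turns moments of order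
`β` of a measure `μ` into `m`-integrability over the unit ball of `∫ (1 - exp (i⟨ξ, x⟩)) μ(dx)` or
of its real part.

For the Lévy measure this links `∫_{‖x‖ > 1} ‖x‖ ^ β ν(dx)` with `Re Ψ` and `Ψ`, because drift,
Gaussian part and small jumps contribute only `O(‖ξ‖)` to `Ψ`. For the law of `X_t` it links
`E ‖X_t‖ ^ β` with `1 - exp (-t Ψ)`, which is dominated by `t Ψ`, while `t Re Ψ` is dominated by
`exp (t Ψ) - 1 = exp (t Ψ) (1 - exp (-t Ψ))`.
-/

theorem mem_closedBall_and_inner_mem_Icc_of_mem_ball {E : Type*} [NormedAddCommGroup E]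
    [InnerProductSpace ℝ E] {u ξ : E} (hu : ‖u‖ = 1)
    (hξ : ξ ∈ Metric.ball ((3 / 4 : ℝ) • u) (1 / 4)) :
    ξ ∈ Metric.closedBall 0 1 ∧ inner ℝ ξ u ∈ Set.Icc (1 / 2 : ℝ) 1 := by
  have hnorm := norm_le_norm_add_norm_sub' ξ ((3 / 4 : ℝ) • u)
  have hinner := abs_real_inner_le_norm (ξ - (3 / 4 : ℝ) • u) u
  rw [norm_smul, hu, Real.norm_of_nonneg (by norm_num)] at hnorm
  rw [inner_sub_left, real_inner_smul_left, real_inner_self_eq_norm_sq, hu, abs_le] at hinner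
  rw [mem_ball_iff_norm] at hξ
  exact ⟨mem_closedBall_zero_iff.2 (by linarith), by linarith, by linarith⟩

section StableLevyMeasure

variable {E : Type*} [NormedAddCommGroup E] [InnerProductSpace ℝ E] [FiniteDimensional ℝ E]
  [MeasurableSpace E] [BorelSpace E]

variable (E) in
/-- The Lévy measure `‖ξ‖ ^ (-(dim E + β)) dξ` of the isotropic `β`-stable process on `E`, up to
normalisation. The real power makes the density `0` at `ξ = 0`, so on the trivial space the measure
is zero for `β ≠ 0`. -/
noncomputable def stableLevyMeasure (β : ℝ) : Measure E :=
  volume.withDensity fun ξ => ENNReal.ofReal (‖ξ‖ ^ (-(Module.finrank ℝ E + β)))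

instance (β : ℝ) : SFinite (stableLevyMeasure E β) := by
  unfold stableLevyMeasure
  infer_instance

theorem integrableOn_stableLevyMeasure_iff {F : Type*} [NormedAddCommGroup F] [NormedSpace ℝ F]
    {β : ℝ} {s : Set E} (hs : MeasurableSet s) {f : E → F} :
    IntegrableOn f s (stableLevyMeasure E β) ↔
      IntegrableOn (fun ξ => ‖ξ‖ ^ (-(Module.finrank ℝ E + β)) • f ξ) s := by
  rw [IntegrableOn, stableLevyMeasure, restrict_withDensity hs,
    integrable_withDensity_iff_integrable_smul' (by fun_prop)
      (ae_of_all _ fun _ => ENNReal.ofReal_lt_top)]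
  simp only [ENNReal.toReal_ofReal (Real.rpow_nonneg (norm_nonneg _) _), IntegrableOn]

theorem map_smul_stableLevyMeasure (β : ℝ) {r : ℝ} (hr : 0 < r) :
    (stableLevyMeasure E β).map (r • ·) = ENNReal.ofReal (r ^ β) • stableLevyMeasure E β := by
  have hmeas (a : ℝ) : Measurable fun ξ : E => ENNReal.ofReal (‖ξ‖ ^ a) := by fun_prop
  set a : ℝ := -(Module.finrank ℝ E + β) with ha
  have hdensity (ξ : E) : ENNReal.ofReal (‖ξ‖ ^ a)
      = ENNReal.ofReal (r ^ (-a)) * ENNReal.ofReal (‖r • ξ‖ ^ a) := by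
    rw [← ENNReal.ofReal_mul (by positivity), norm_smul, Real.norm_of_nonneg hr.le,
      Real.mul_rpow hr.le (norm_nonneg _), ← mul_assoc, ← Real.rpow_add hr, neg_add_cancel,
      Real.rpow_zero, one_mul]
  have hconst : ENNReal.ofReal (r ^ (-a)) * ENNReal.ofReal |(r ^ Module.finrank ℝ E)⁻¹|
      = ENNReal.ofReal (r ^ β) := by
    rw [← ENNReal.ofReal_mul (by positivity), abs_of_pos (by positivity), ha, neg_neg,
      Real.rpow_add hr, Real.rpow_natCast, mul_comm, inv_mul_cancel_left₀ (by positivity)]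
  refine Measure.ext_of_lintegral _ fun f hf => ?_
  rw [lintegral_map hf (by fun_prop), lintegral_smul_measure, smul_eq_mul, stableLevyMeasure,
    lintegral_withDensity_eq_lintegral_mul _ (hmeas a) (by fun_prop),
    lintegral_withDensity_eq_lintegral_mul _ (hmeas a) hf]
  calc ∫⁻ ξ : E, ENNReal.ofReal (‖ξ‖ ^ a) * f (r • ξ)
      = ENNReal.ofReal (r ^ (-a)) * ∫⁻ ξ : E, ENNReal.ofReal (‖r • ξ‖ ^ a) * f (r • ξ) := by
        rw [← lintegral_const_mul _ (by fun_prop)]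
        exact lintegral_congr fun ξ => by rw [hdensity, mul_assoc]
    _ = ENNReal.ofReal (r ^ (-a)) * ∫⁻ ξ, ENNReal.ofReal (‖ξ‖ ^ a) * f ξ
          ∂(volume : Measure E).map (r • ·) := by
        rw [lintegral_map (by fun_prop) (by fun_prop)]
    _ = ENNReal.ofReal (r ^ β) * ∫⁻ ξ : E, ENNReal.ofReal (‖ξ‖ ^ a) * f ξ := by
        rw [Measure.map_addHaar_smul _ hr.ne', lintegral_smul_measure, smul_eq_mul, ← mul_assoc,
          hconst]

theorem integrable_comp_smul_stableLevyMeasure_iff {F : Type*} [NormedAddCommGroup F] (β : ℝ)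
    {r : ℝ} (hr : 0 < r) {f : E → F} :
    Integrable (fun ξ => f (r • ξ)) (stableLevyMeasure E β)
      ↔ Integrable f (stableLevyMeasure E β) := by
  rw [← integrable_smul_measure (c := ENNReal.ofReal (r ^ β)) (f := f)
      (ENNReal.ofReal_pos.2 (by positivity)).ne' ENNReal.ofReal_ne_top,
    ← map_smul_stableLevyMeasure β hr]
  exact (integrable_map_equiv (MeasurableEquiv.smul₀ r hr.ne') f).symm

theorem integral_comp_smul_stableLevyMeasure {F : Type*} [NormedAddCommGroup F] [NormedSpace ℝ F]
    (β : ℝ) {r : ℝ} (hr : 0 < r) (f : E → F) :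
    ∫ ξ, f (r • ξ) ∂stableLevyMeasure E β = r ^ β • ∫ ξ, f ξ ∂stableLevyMeasure E β := by
  rw [← ENNReal.toReal_ofReal (Real.rpow_nonneg hr.le β), ← integral_smul_measure,
    ← map_smul_stableLevyMeasure β hr]
  exact (integral_map_equiv (MeasurableEquiv.smul₀ r hr.ne') f).symm

theorem lintegral_comp_smul_stableLevyMeasure (β : ℝ) {r : ℝ} (hr : 0 < r) (f : E → ℝ≥0∞) :
    ∫⁻ ξ, f (r • ξ) ∂stableLevyMeasure E β
      = ENNReal.ofReal (r ^ β) * ∫⁻ ξ, f ξ ∂stableLevyMeasure E β := by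
  rw [← smul_eq_mul, ← lintegral_smul_measure, ← map_smul_stableLevyMeasure β hr]
  exact (lintegral_map_equiv f (MeasurableEquiv.smul₀ r hr.ne')).symm

theorem integrable_min_two_norm_stableLevyMeasure {β : ℝ} (hβ : β ∈ Set.Ioo (0 : ℝ) 1) :
    Integrable (fun ξ => min 2 ‖ξ‖) (stableLevyMeasure E β) := by
  have hradial : IntegrableOn (fun y : ℝ => y ^ (-β - 1) * min 2 y) (Set.Ioi 0) := by
    refine mellin_convergent_of_isBigO_scalar (a := 0) (b := -1)
      ((continuous_const.min continuous_id).locallyIntegrable.locallyIntegrableOn _) ?_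
      (by linarith [hβ.1]) ?_ (by linarith [hβ.2])
    · refine Asymptotics.IsBigO.of_bound 2 ((eventually_ge_atTop 0).mono fun y hy => ?_)
      simp [abs_of_nonneg (le_min zero_le_two hy)]
    · refine Asymptotics.IsBigO.of_bound 1 (eventually_mem_nhdsWithin.mono fun y hy => ?_)
      have hy : 0 ≤ y := le_of_lt hy
      simp [abs_of_nonneg (le_min zero_le_two hy), abs_of_nonneg hy]
  rcases subsingleton_or_nontrivial E with hE | hE
  · simp [Subsingleton.elim _ (0 : E)]
  rw [← integrableOn_univ, integrableOn_stableLevyMeasure_iff .univ, integrableOn_univ,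
    integrable_fun_norm_addHaar volume
      (f := fun y => y ^ (-(Module.finrank ℝ E + β)) • min 2 y)]
  refine hradial.congr_fun (fun y (hy : 0 < y) => ?_) measurableSet_Ioi
  simp only [smul_eq_mul]
  rw [← mul_assoc, ← Real.rpow_natCast, ← Real.rpow_add hy, Nat.cast_pred Module.finrank_pos]
  ring_nf

theorem integrableOn_norm_stableLevyMeasure {β : ℝ} (hβ : β ∈ Set.Ioo (0 : ℝ) 1) :
    IntegrableOn (fun ξ => ‖ξ‖) (Metric.closedBall 0 1) (stableLevyMeasure E β) := by
  refine (integrable_min_two_norm_stableLevyMeasure hβ).integrableOn.congr_fun (fun ξ hξ => ?_)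
    Metric.isClosed_closedBall.measurableSet
  exact min_eq_right ((mem_closedBall_zero_iff.1 hξ).trans one_le_two)

theorem integral_min_two_norm_mul_stableLevyMeasure {β : ℝ} (hβ : 0 < β) {r : ℝ} (hr : 0 ≤ r) :
    ∫ ξ, min 2 (‖ξ‖ * r) ∂stableLevyMeasure E β
      = r ^ β * ∫ ξ, min 2 ‖ξ‖ ∂stableLevyMeasure E β := by
  rcases hr.eq_or_lt with rfl | hr
  · simp [Real.zero_rpow hβ.ne']
  · simpa [norm_smul, abs_of_pos hr, mul_comm r]
      using integral_comp_smul_stableLevyMeasure β hr fun ξ : E => min 2 ‖ξ‖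

theorem integrable_min_two_norm_mul_norm {β : ℝ} (hβ : β ∈ Set.Ioo (0 : ℝ) 1) {μ : Measure E}
    [SFinite μ] (hμ : Integrable (fun x => ‖x‖ ^ β) μ) :
    Integrable (fun p : E × E => min 2 (‖p.1‖ * ‖p.2‖)) ((stableLevyMeasure E β).prod μ) := by
  rw [integrable_prod_iff' (Continuous.aestronglyMeasurable (by fun_prop))]
  constructor
  · refine ae_of_all _ fun x => ?_
    rcases eq_or_ne x 0 with rfl | hx
    · simp
    · simpa [norm_smul, mul_comm ‖x‖] using
        (integrable_comp_smul_stableLevyMeasure_iff β (norm_pos_iff.2 hx)).2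
          (integrable_min_two_norm_stableLevyMeasure (E := E) hβ)
  · have hnonneg (x ξ : E) : 0 ≤ min 2 (‖ξ‖ * ‖x‖) := by positivity
    simp_rw [Real.norm_of_nonneg (hnonneg _ _),
      integral_min_two_norm_mul_stableLevyMeasure hβ.1 (norm_nonneg _)]
    exact hμ.mul_const _

theorem volume_le_stableLevyMeasure {β : ℝ} (hβ : 0 ≤ β) {s : Set E} (hs : MeasurableSet s)
    (hs1 : s ⊆ Metric.closedBall 0 1 \ {0}) : volume s ≤ stableLevyMeasure E β s := by
  rw [stableLevyMeasure, withDensity_apply _ hs, ← setLIntegral_one]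
  refine setLIntegral_mono' hs fun ξ hξ => ENNReal.one_le_ofReal.2 ?_
  obtain ⟨hξ1, hξ0⟩ := hs1 hξ
  exact Real.one_le_rpow_of_pos_of_le_one_of_nonpos (norm_pos_iff.2 hξ0)
    (mem_closedBall_zero_iff.1 hξ1) (neg_nonpos.2 (by positivity))

variable (E) in
theorem exists_pos_forall_norm_eq_one_le_setLIntegral_one_sub_cos {β : ℝ} (hβ : 0 ≤ β) :
    ∃ c > 0, ∀ u : E, ‖u‖ = 1 → ENNReal.ofReal c ≤ ∫⁻ ξ in Metric.closedBall 0 1,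
      ENNReal.ofReal (1 - Real.cos (inner ℝ ξ u)) ∂stableLevyMeasure E β := by
  have hcos : Real.cos (1 / 2) < 1 := by
    simpa using Real.cos_lt_cos_of_nonneg_of_le_pi le_rfl
      (by linarith [Real.pi_gt_three]) (by norm_num : (0 : ℝ) < 1 / 2)
  have hvol : 0 < volume.real (Metric.ball (0 : E) (1 / 4)) :=
    ENNReal.toReal_pos (Metric.measure_ball_pos _ _ (by norm_num)).ne' measure_ball_lt_top.ne
  refine ⟨(1 - Real.cos (1 / 2)) * volume.real (Metric.ball (0 : E) (1 / 4)),
    mul_pos (sub_pos.2 hcos) hvol, fun u hu => ?_⟩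
  set B := Metric.ball ((3 / 4 : ℝ) • u) (1 / 4)
  have hball {ξ : E} (hξ : ξ ∈ B) := mem_closedBall_and_inner_mem_Icc_of_mem_ball hu hξ
  have hB : B ⊆ Metric.closedBall 0 1 \ {0} := fun ξ hξ => by
    refine ⟨(hball hξ).1, ?_⟩
    rintro rfl
    simpa using (hball hξ).2.1.trans_lt' one_half_pos
  calc ENNReal.ofReal ((1 - Real.cos (1 / 2)) * volume.real (Metric.ball (0 : E) (1 / 4)))
      = ENNReal.ofReal (1 - Real.cos (1 / 2)) * volume B := by
        rw [ENNReal.ofReal_mul (sub_pos.2 hcos).le, ofReal_measureReal,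
          ← Measure.addHaar_ball_center]
    _ ≤ ENNReal.ofReal (1 - Real.cos (1 / 2)) * stableLevyMeasure E β B := by
        exact mul_le_mul' le_rfl (volume_le_stableLevyMeasure hβ measurableSet_ball hB)
    _ = ∫⁻ _ in B, ENNReal.ofReal (1 - Real.cos (1 / 2)) ∂stableLevyMeasure E β :=
        (setLIntegral_const _ _).symm
    _ ≤ ∫⁻ ξ in B, ENNReal.ofReal (1 - Real.cos (inner ℝ ξ u)) ∂stableLevyMeasure E β := by
        refine setLIntegral_mono' measurableSet_ball fun ξ hξ => ?_
        gcongr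
        exact Real.cos_le_cos_of_nonneg_of_le_pi (by norm_num)
          (by linarith [Real.pi_gt_three, (hball hξ).2.2]) (hball hξ).2.1
    _ ≤ _ := lintegral_mono_set fun ξ hξ => (hball hξ).1

variable (E) in
theorem exists_pos_forall_one_le_norm_le_setLIntegral_one_sub_cos {β : ℝ} (hβ : 0 ≤ β) :
    ∃ c > 0, ∀ x : E, 1 ≤ ‖x‖ → ENNReal.ofReal (c * ‖x‖ ^ β) ≤ ∫⁻ ξ in Metric.closedBall 0 1,
      ENNReal.ofReal (1 - Real.cos (inner ℝ ξ x)) ∂stableLevyMeasure E β := by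
  obtain ⟨c, hc, hunit⟩ := exists_pos_forall_norm_eq_one_le_setLIntegral_one_sub_cos E hβ
  refine ⟨c, hc, fun x hx => ?_⟩
  have hx0 : 0 < ‖x‖ := one_pos.trans_le hx
  set u := ‖x‖⁻¹ • x with hu
  have hinner (ξ : E) : inner ℝ (‖x‖ • ξ) u = inner ℝ ξ x := by
    rw [hu, real_inner_smul_left, real_inner_smul_right, mul_inv_cancel_left₀ hx0.ne']
  let f : E → ℝ≥0∞ := (Metric.closedBall 0 1).indicator fun ξ =>
    ENNReal.ofReal (1 - Real.cos (inner ℝ ξ u))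
  calc ENNReal.ofReal (c * ‖x‖ ^ β)
      ≤ ENNReal.ofReal (‖x‖ ^ β) * ∫⁻ ξ, f ξ ∂stableLevyMeasure E β := by
        rw [mul_comm, ENNReal.ofReal_mul (by positivity),
          lintegral_indicator Metric.isClosed_closedBall.measurableSet]
        gcongr
        exact hunit u (norm_smul_inv_norm (norm_pos_iff.1 hx0))
    _ = ∫⁻ ξ, f (‖x‖ • ξ) ∂stableLevyMeasure E β :=
        (lintegral_comp_smul_stableLevyMeasure β hx0 f).symm
    _ ≤ _ := by
        rw [← lintegral_indicator Metric.isClosed_closedBall.measurableSet]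
        refine lintegral_mono fun ξ => ?_
        refine Set.indicator_apply_le' (fun hξ => ?_) fun _ => zero_le
        rw [mem_closedBall_zero_iff, norm_smul, norm_norm] at hξ
        have hξ1 : ‖ξ‖ ≤ 1 := (le_mul_of_one_le_left (norm_nonneg ξ) hx).trans hξ
        rw [Set.indicator_of_mem (mem_closedBall_zero_iff.2 hξ1), hinner]

theorem integrableOn_norm_rpow_of_integrableOn_integral_one_sub_cos {β : ℝ} (hβ : 0 ≤ β)
    {μ : Measure E} [SFinite μ]
    (hint : ∀ ξ : E, ‖ξ‖ ≤ 1 → Integrable (fun x => 1 - Real.cos (inner ℝ ξ x)) μ)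
    (h : IntegrableOn (fun ξ => ∫ x, (1 - Real.cos (inner ℝ ξ x)) ∂μ) (Metric.closedBall 0 1)
      (stableLevyMeasure E β)) :
    IntegrableOn (fun x => ‖x‖ ^ β) {x | 1 < ‖x‖} μ := by
  have hnonneg (ξ x : E) : 0 ≤ 1 - Real.cos (inner ℝ ξ x) := sub_nonneg.2 (Real.cos_le_one _)
  have hprod : Integrable (fun p : E × E => 1 - Real.cos (inner ℝ p.1 p.2))
      (((stableLevyMeasure E β).restrict (Metric.closedBall 0 1)).prod μ) := by
    rw [integrable_prod_iff (Continuous.aestronglyMeasurable (by fun_prop))]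
    simp_rw [Real.norm_of_nonneg (hnonneg _ _)]
    refine ⟨?_, h⟩
    filter_upwards [ae_restrict_mem Metric.isClosed_closedBall.measurableSet] with ξ hξ
    exact hint ξ (mem_closedBall_zero_iff.1 hξ)
  obtain ⟨c, hc, hle⟩ := exists_pos_forall_one_le_norm_le_setLIntegral_one_sub_cos E hβ
  have hS : MeasurableSet {x : E | 1 < ‖x‖} := measurableSet_lt measurable_const measurable_norm
  refine (hprod.integral_prod_right.const_mul c⁻¹).integrableOn.mono'
    (Measurable.aestronglyMeasurable (by fun_prop)) ?_
  filter_upwards [ae_restrict_of_ae hprod.prod_left_ae, ae_restrict_mem hS] with x hintx hx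
  have hlex := hle x (le_of_lt hx)
  rw [← ofReal_integral_eq_lintegral_ofReal hintx (ae_of_all _ fun ξ => hnonneg ξ x),
    ENNReal.ofReal_le_ofReal_iff (integral_nonneg fun ξ => hnonneg ξ x)] at hlex
  rwa [Real.norm_of_nonneg (by positivity), le_inv_mul_iff₀ hc]

theorem integrableOn_inner_stableLevyMeasure {β : ℝ} (hβ : β ∈ Set.Ioo (0 : ℝ) 1) {F : E → E}
    (hF : Continuous F) :
    IntegrableOn (fun ξ => inner ℝ (F ξ) ξ) (Metric.closedBall 0 1) (stableLevyMeasure E β) := by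
  have hnorm := integrableOn_norm_stableLevyMeasure (E := E) hβ
  refine (hnorm.continuousOn_mul hF.norm.continuousOn (isCompact_closedBall 0 1)).mono'
    (Continuous.aestronglyMeasurable (by fun_prop)) (ae_of_all _ fun ξ => ?_)
  exact abs_real_inner_le_norm _ _

end StableLevyMeasure

section CharFun

variable {E : Type*} [NormedAddCommGroup E] [InnerProductSpace ℝ E]

theorem re_one_sub_exp_I_mul (y : ℝ) : (1 - Complex.exp (Complex.I * y)).re = 1 - Real.cos y := by
  rw [mul_comm, Complex.sub_re, Complex.one_re, Complex.exp_ofReal_mul_I_re]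

theorem norm_one_sub_exp_I_mul_inner_le (ξ x : E) :
    ‖1 - Complex.exp (Complex.I * (inner ℝ ξ x : ℝ))‖ ≤ min 2 (‖ξ‖ * ‖x‖) := by
  refine le_min ?_ ?_
  · refine (norm_sub_le _ _).trans_eq ?_
    rw [mul_comm, Complex.norm_exp_ofReal_mul_I, norm_one, one_add_one_eq_two]
  · rw [norm_sub_rev]
    exact Real.norm_exp_I_mul_ofReal_sub_one_le.trans (abs_real_inner_le_norm ξ x)

variable [MeasurableSpace E] [BorelSpace E]

theorem integrable_one_sub_exp_I_mul_inner (μ : Measure E) [IsFiniteMeasure μ] (ξ : E) :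
    Integrable (fun x => 1 - Complex.exp (Complex.I * (inner ℝ ξ x : ℝ))) μ :=
  .of_bound (Continuous.aestronglyMeasurable (by fun_prop)) 2
    (ae_of_all _ fun x => (norm_one_sub_exp_I_mul_inner_le ξ x).trans (min_le_left _ _))

theorem one_sub_charFun (μ : Measure E) [IsProbabilityMeasure μ] (ξ : E) :
    1 - charFun μ ξ = ∫ x, (1 - Complex.exp (Complex.I * (inner ℝ ξ x : ℝ))) ∂μ := by
  have hexp : Integrable (fun x => Complex.exp (Complex.I * (inner ℝ ξ x : ℝ))) μ :=
    ((integrable_const 1).sub (integrable_one_sub_exp_I_mul_inner μ ξ)).congr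
      (ae_of_all _ fun x => sub_sub_cancel _ _)
  rw [integral_sub (integrable_const _) hexp, integral_const, probReal_univ, one_smul,
    charFun_apply]
  simp_rw [real_inner_comm ξ, mul_comm Complex.I]

variable [FiniteDimensional ℝ E]

theorem integrable_prod_one_sub_exp_I_mul_inner {β : ℝ} (hβ : β ∈ Set.Ioo (0 : ℝ) 1)
    {μ : Measure E} [SFinite μ] (hμ : Integrable (fun x => ‖x‖ ^ β) μ) :
    Integrable (fun p : E × E => 1 - Complex.exp (Complex.I * (inner ℝ p.1 p.2 : ℝ)))
      ((stableLevyMeasure E β).prod μ) :=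
  (integrable_min_two_norm_mul_norm hβ hμ).mono' (Continuous.aestronglyMeasurable (by fun_prop))
    (ae_of_all _ fun p => norm_one_sub_exp_I_mul_inner_le p.1 p.2)

theorem integrable_one_sub_charFun {β : ℝ} (hβ : β ∈ Set.Ioo (0 : ℝ) 1) {μ : Measure E}
    [IsProbabilityMeasure μ] (hμ : Integrable (fun x => ‖x‖ ^ β) μ) :
    Integrable (fun ξ => 1 - charFun μ ξ) (stableLevyMeasure E β) := by
  simp_rw [one_sub_charFun]
  exact (integrable_prod_one_sub_exp_I_mul_inner hβ hμ).integral_prod_left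

theorem integrable_norm_rpow_of_integrableOn_one_sub_charFun {β : ℝ} (hβ : 0 ≤ β) {μ : Measure E}
    [IsProbabilityMeasure μ] (h : IntegrableOn (fun ξ => 1 - charFun μ ξ) (Metric.closedBall 0 1)
      (stableLevyMeasure E β)) :
    Integrable (fun x => ‖x‖ ^ β) μ := by
  have hcos (ξ : E) : Integrable (fun x => 1 - Real.cos (inner ℝ ξ x)) μ :=
    (integrable_one_sub_exp_I_mul_inner μ ξ).re.congr
      (ae_of_all _ fun x => re_one_sub_exp_I_mul _)
  have hre (ξ : E) : (1 - charFun μ ξ).re = ∫ x, (1 - Real.cos (inner ℝ ξ x)) ∂μ := by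
    simp_rw [one_sub_charFun, ← re_one_sub_exp_I_mul]
    exact (integral_re (integrable_one_sub_exp_I_mul_inner μ ξ)).symm
  have hlarge : IntegrableOn (fun x => ‖x‖ ^ β) {x | 1 < ‖x‖} μ :=
    integrableOn_norm_rpow_of_integrableOn_integral_one_sub_cos hβ (fun ξ _ => hcos ξ)
      (h.re.congr (ae_of_all _ hre))
  have hsmall : IntegrableOn (fun x => ‖x‖ ^ β) {x | ‖x‖ ≤ 1} μ := by
    refine .of_bound (measure_lt_top _ _) (Measurable.aestronglyMeasurable (by fun_prop)) 1 ?_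
    refine (ae_restrict_mem (measurableSet_le measurable_norm measurable_const)).mono
      fun x hx => ?_
    rw [Real.norm_of_nonneg (by positivity)]
    exact Real.rpow_le_one (norm_nonneg x) hx hβ
  rw [← integrableOn_univ]
  exact (hsmall.union hlarge).mono_set fun x _ => le_or_gt ‖x‖ 1

end CharFun

section ComplexExp

theorem re_le_norm_exp_sub_one (z : ℂ) : z.re ≤ ‖Complex.exp z - 1‖ := by
  have h := norm_sub_norm_le (Complex.exp z) 1
  rw [Complex.norm_exp, norm_one] at h
  linarith [Real.add_one_le_exp z.re]

theorem norm_one_sub_exp_neg_le {z : ℂ} (hz : 0 ≤ z.re) : ‖1 - Complex.exp (-z)‖ ≤ ‖z‖ := by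
  have h := (convex_halfSpace_re_ge 0).norm_image_sub_le_of_norm_hasDerivWithin_le
    (f := fun z => Complex.exp (-z)) (f' := fun z => -Complex.exp (-z)) (C := 1)
    (fun w _ => by simpa using (hasDerivAt_neg w).cexp.hasDerivWithinAt)
    (fun w hw => by simpa [Complex.norm_exp] using hw) hz (le_refl (0 : ℂ).re)
  simpa using h

variable {X : Type*} [MeasurableSpace X] {m : Measure X} {K : Set X} {f : X → ℂ}

theorem integrableOn_one_sub_exp_neg (hK : MeasurableSet K) (hre : ∀ x ∈ K, 0 ≤ (f x).re)
    (hf : IntegrableOn f K m) : IntegrableOn (fun x => 1 - Complex.exp (-f x)) K m := by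
  refine hf.norm.mono' ?_
    ((ae_restrict_mem hK).mono fun x hx => norm_one_sub_exp_neg_le (hre x hx))
  exact Continuous.comp_aestronglyMeasurable (g := fun z => 1 - Complex.exp (-z)) (by fun_prop)
    hf.aestronglyMeasurable

theorem integrableOn_re_of_integrableOn_one_sub_exp_neg [TopologicalSpace X] [T2Space X]
    [OpensMeasurableSpace X] (hK : IsCompact K) (hre : ∀ x ∈ K, 0 ≤ (f x).re)
    (hfm : AEStronglyMeasurable f (m.restrict K))
    (hcont : ContinuousOn (fun x => Complex.exp (-f x)) K)
    (h : IntegrableOn (fun x => 1 - Complex.exp (-f x)) K m) :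
    IntegrableOn (fun x => (f x).re) K m := by
  -- Dividing `1 - exp (-f)` by `exp (-f)`, whose inverse is bounded on `K`, gives `exp f - 1`.
  have hexp : IntegrableOn (fun x => Complex.exp (f x) - 1) K m := by
    refine (h.continuousOn_mul (hcont.inv₀ fun x _ => Complex.exp_ne_zero _) hK).congr
      (ae_of_all _ fun x => ?_)
    simp [mul_sub, ← Complex.exp_neg, ← Complex.exp_add]
  refine hexp.norm.mono' hfm.re ((ae_restrict_mem hK.measurableSet).mono fun x hx => ?_)
  rw [Real.norm_of_nonneg (hre x hx)]
  exact re_le_norm_exp_sub_one _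

end ComplexExp

section LevyIntegrand

variable {E : Type*} [NormedAddCommGroup E] [InnerProductSpace ℝ E]

/-- The compensated integrand of the Lévy–Khintchine formula, so that the jump part of
`levyExponent b Q ν ξ` is `∫ x, levyIntegrand ξ x ∂ν`. -/
noncomputable def levyIntegrand (ξ x : E) : ℂ :=
  1 - Complex.exp (Complex.I * (inner ℝ ξ x : ℝ))
    + Set.indicator {y : E | ‖y‖ ≤ 1} (fun y => Complex.I * (inner ℝ ξ y : ℝ)) x

theorem re_levyIntegrand (ξ x : E) : (levyIntegrand ξ x).re = 1 - Real.cos (inner ℝ ξ x) := by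
  rw [levyIntegrand, Complex.add_re, re_one_sub_exp_I_mul, add_eq_left, Set.indicator_apply]
  split_ifs <;> simp

theorem levyIntegrand_eq_of_one_lt_norm (ξ : E) {x : E} (hx : 1 < ‖x‖) :
    levyIntegrand ξ x = 1 - Complex.exp (Complex.I * (inner ℝ ξ x : ℝ)) := by
  rw [levyIntegrand, Set.indicator_of_notMem (by simpa using hx), add_zero]

theorem norm_levyIntegrand_le_of_norm_le_one {ξ x : E} (hξ : ‖ξ‖ ≤ 1) (hx : ‖x‖ ≤ 1) :
    ‖levyIntegrand ξ x‖ ≤ ‖ξ‖ * ‖x‖ ^ 2 := by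
  have hinner : |inner ℝ ξ x| ≤ ‖ξ‖ * ‖x‖ := abs_real_inner_le_norm ξ x
  have hnorm : ‖Complex.I * (inner ℝ ξ x : ℝ)‖ = |inner ℝ ξ x| := by simp
  have hle : ‖Complex.I * (inner ℝ ξ x : ℝ)‖ ≤ 1 :=
    hnorm.trans_le (hinner.trans (mul_le_one₀ hξ (norm_nonneg x) hx))
  calc ‖levyIntegrand ξ x‖
      = ‖Complex.exp (Complex.I * (inner ℝ ξ x : ℝ)) - 1 - Complex.I * (inner ℝ ξ x : ℝ)‖ := by
        rw [levyIntegrand, Set.indicator_of_mem (by simpa using hx), ← norm_neg]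
        ring_nf
    _ ≤ (‖ξ‖ * ‖x‖) ^ 2 := by
        refine (Complex.norm_exp_sub_one_sub_id_le hle).trans ?_
        rw [hnorm]
        gcongr
    _ ≤ ‖ξ‖ * ‖x‖ ^ 2 := by
        rw [mul_pow]
        gcongr
        exact pow_le_of_le_one (norm_nonneg ξ) hξ two_ne_zero

theorem norm_levyIntegrand_le_two_mul_min {ξ : E} (hξ : ‖ξ‖ ≤ 1) (x : E) :
    ‖levyIntegrand ξ x‖ ≤ 2 * min 1 (‖x‖ ^ 2) := by
  rcases le_or_gt ‖x‖ 1 with hx | hx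
  · rw [min_eq_right (pow_le_one₀ (norm_nonneg x) hx)]
    have hsmall := norm_levyIntegrand_le_of_norm_le_one hξ hx
    nlinarith [sq_nonneg ‖x‖]
  · rw [min_eq_left (one_le_pow₀ hx.le), levyIntegrand_eq_of_one_lt_norm ξ hx, mul_one]
    exact (norm_one_sub_exp_I_mul_inner_le ξ x).trans (min_le_left _ _)

variable [MeasurableSpace E] [BorelSpace E] [FiniteDimensional ℝ E]

theorem measurable_levyIntegrand : Measurable fun p : E × E => levyIntegrand p.1 p.2 := by
  have hball : MeasurableSet {p : E × E | ‖p.2‖ ≤ 1} :=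
    measurableSet_le (by fun_prop) measurable_const
  have hlin : Measurable fun p : E × E => Complex.I * (inner ℝ p.1 p.2 : ℝ) := by fun_prop
  exact Measurable.add (by fun_prop) (hlin.indicator hball)

theorem integrableOn_prod_levyIntegrand_one_lt_norm {β : ℝ} (hβ : β ∈ Set.Ioo (0 : ℝ) 1)
    {ν : Measure E} [SFinite ν] (hν : IntegrableOn (fun x => ‖x‖ ^ β) {x | 1 < ‖x‖} ν) :
    IntegrableOn (fun p => levyIntegrand p.1 p.2) (Set.univ ×ˢ {x | 1 < ‖x‖})
      ((stableLevyMeasure E β).prod ν) := by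
  have hL : MeasurableSet {x : E | 1 < ‖x‖} := measurableSet_lt measurable_const measurable_norm
  have hexp := integrable_prod_one_sub_exp_I_mul_inner hβ hν
  rw [← Measure.restrict_univ (μ := stableLevyMeasure E β), Measure.prod_restrict] at hexp
  exact IntegrableOn.congr_fun hexp (fun p hp => (levyIntegrand_eq_of_one_lt_norm p.1 hp.2).symm)
    (MeasurableSet.univ.prod hL)

end LevyIntegrand

namespace IsLevyMeasure

variable {n : ℕ} {ν : Measure (EuclideanSpace ℝ (Fin n))}

theorem integrable_min_one_norm_sq (hν : IsLevyMeasure ν) :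
    Integrable (fun x => min 1 (‖x‖ ^ 2)) ν := by
  refine ⟨Measurable.aestronglyMeasurable (by fun_prop), ?_⟩
  rw [hasFiniteIntegral_iff_ofReal (ae_of_all _ fun x => by positivity)]
  exact hν.integrable

theorem sFinite (hν : IsLevyMeasure ν) : SFinite ν := by
  set g : EuclideanSpace ℝ (Fin n) → ℝ≥0∞ := fun x => ENNReal.ofReal (min 1 (‖x‖ ^ 2))
  have hfin : IsFiniteMeasure (ν.withDensity g) := isFiniteMeasure_withDensity hν.integrable.ne
  have hne : ∀ᵐ x ∂ν, g x ≠ 0 := by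
    filter_upwards [compl_mem_ae_iff.2 hν.zero] with x (hx : x ≠ 0)
    exact (ENNReal.ofReal_pos.2 (by positivity)).ne'
  rw [← withDensity_inv_same (by fun_prop) hne (ae_of_all _ fun _ => ENNReal.ofReal_ne_top)]
  infer_instance

theorem integrable_levyIntegrand (hν : IsLevyMeasure ν) {ξ : EuclideanSpace ℝ (Fin n)}
    (hξ : ‖ξ‖ ≤ 1) : Integrable (levyIntegrand ξ) ν :=
  (hν.integrable_min_one_norm_sq.const_mul 2).mono'
    (measurable_levyIntegrand.comp measurable_prodMk_left).aestronglyMeasurable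
    (ae_of_all _ (norm_levyIntegrand_le_two_mul_min hξ))

theorem integrableOn_norm_sq (hν : IsLevyMeasure ν) :
    IntegrableOn (fun x => ‖x‖ ^ 2) {x | ‖x‖ ≤ 1} ν :=
  hν.integrable_min_one_norm_sq.integrableOn.congr_fun
    (fun x (hx : ‖x‖ ≤ 1) => min_eq_right (pow_le_one₀ (norm_nonneg x) hx))
    (measurableSet_le measurable_norm measurable_const)

theorem measurable_levyExponent (hν : IsLevyMeasure ν) (b : EuclideanSpace ℝ (Fin n))
    (Q : Matrix (Fin n) (Fin n) ℝ) : Measurable (levyExponent b Q ν) := by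
  have := hν.sFinite
  have hjump : Measurable fun ξ => ∫ x, levyIntegrand ξ x ∂ν :=
    measurable_levyIntegrand.stronglyMeasurable.integral_prod_right.measurable
  exact Measurable.add (by fun_prop) hjump

theorem integral_one_sub_cos_le_re_levyExponent (hν : IsLevyMeasure ν)
    (b : EuclideanSpace ℝ (Fin n)) {Q : Matrix (Fin n) (Fin n) ℝ} (hQ : Q.PosSemidef)
    {ξ : EuclideanSpace ℝ (Fin n)} (hξ : ‖ξ‖ ≤ 1) :
    ∫ x, (1 - Real.cos (inner ℝ ξ x)) ∂ν ≤ (levyExponent b Q ν ξ).re := by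
  have hjump : (∫ x, levyIntegrand ξ x ∂ν).re = ∫ x, (1 - Real.cos (inner ℝ ξ x)) ∂ν := by
    simp_rw [← re_levyIntegrand]
    exact (integral_re (hν.integrable_levyIntegrand hξ)).symm
  have hgauss : 0 ≤ ξ.ofLp ⬝ᵥ Q.mulVec ξ.ofLp := by
    simpa using hQ.dotProduct_mulVec_nonneg ξ.ofLp
  have hsum : (levyExponent b Q ν ξ).re
      = 1 / 2 * (ξ.ofLp ⬝ᵥ Q.mulVec ξ.ofLp) + (∫ x, levyIntegrand ξ x ∂ν).re := by
    simp [levyExponent, levyIntegrand]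
  rw [hsum, hjump]
  linarith

theorem re_levyExponent_nonneg (hν : IsLevyMeasure ν) (b : EuclideanSpace ℝ (Fin n))
    {Q : Matrix (Fin n) (Fin n) ℝ} (hQ : Q.PosSemidef) {ξ : EuclideanSpace ℝ (Fin n)}
    (hξ : ‖ξ‖ ≤ 1) : 0 ≤ (levyExponent b Q ν ξ).re :=
  (integral_nonneg fun _ => sub_nonneg.2 (Real.cos_le_one _)).trans
    (hν.integral_one_sub_cos_le_re_levyExponent b hQ hξ)

variable {β : ℝ}

theorem integrableOn_norm_rpow_of_integrableOn_re_levyExponent (hν : IsLevyMeasure ν)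
    {b : EuclideanSpace ℝ (Fin n)} {Q : Matrix (Fin n) (Fin n) ℝ} (hQ : Q.PosSemidef)
    (hβ : 0 ≤ β) (h : IntegrableOn (fun ξ => (levyExponent b Q ν ξ).re) (Metric.closedBall 0 1)
      (stableLevyMeasure _ β)) :
    IntegrableOn (fun x => ‖x‖ ^ β) {x | 1 < ‖x‖} ν := by
  have := hν.sFinite
  have hcos {ξ : EuclideanSpace ℝ (Fin n)} (hξ : ‖ξ‖ ≤ 1) :
      Integrable (fun x => 1 - Real.cos (inner ℝ ξ x)) ν :=
    (hν.integrable_levyIntegrand hξ).re.congr (ae_of_all _ (re_levyIntegrand ξ))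
  have hcont : Continuous fun p : EuclideanSpace ℝ (Fin n) × EuclideanSpace ℝ (Fin n) =>
    1 - Real.cos (inner ℝ p.1 p.2) := by fun_prop
  refine integrableOn_norm_rpow_of_integrableOn_integral_one_sub_cos hβ (fun ξ => hcos) ?_
  refine h.mono' hcont.stronglyMeasurable.integral_prod_right.aestronglyMeasurable ?_
  filter_upwards [ae_restrict_mem Metric.isClosed_closedBall.measurableSet] with ξ hξ
  rw [Real.norm_of_nonneg (integral_nonneg fun _ => sub_nonneg.2 (Real.cos_le_one _))]
  exact hν.integral_one_sub_cos_le_re_levyExponent b hQ (mem_closedBall_zero_iff.1 hξ)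

theorem integrableOn_prod_levyIntegrand_norm_le_one (hν : IsLevyMeasure ν)
    (hβ : β ∈ Set.Ioo (0 : ℝ) 1) :
    IntegrableOn (fun p => levyIntegrand p.1 p.2) (Metric.closedBall 0 1 ×ˢ {x | ‖x‖ ≤ 1})
      ((stableLevyMeasure _ β).prod ν) := by
  have := hν.sFinite
  have hS : MeasurableSet {x : EuclideanSpace ℝ (Fin n) | ‖x‖ ≤ 1} :=
    measurableSet_le measurable_norm measurable_const
  rw [IntegrableOn, ← Measure.prod_restrict]
  refine ((integrableOn_norm_stableLevyMeasure hβ).mul_prod hν.integrableOn_norm_sq).mono'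
    measurable_levyIntegrand.aestronglyMeasurable ?_
  rw [Measure.prod_restrict]
  filter_upwards [ae_restrict_mem (Metric.isClosed_closedBall.measurableSet.prod hS)] with p hp
  exact norm_levyIntegrand_le_of_norm_le_one (mem_closedBall_zero_iff.1 hp.1) hp.2

theorem integrableOn_integral_levyIntegrand (hν : IsLevyMeasure ν) (hβ : β ∈ Set.Ioo (0 : ℝ) 1)
    (h : IntegrableOn (fun x => ‖x‖ ^ β) {x | 1 < ‖x‖} ν) :
    IntegrableOn (fun ξ => ∫ x, levyIntegrand ξ x ∂ν) (Metric.closedBall 0 1)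
      (stableLevyMeasure _ β) := by
  have := hν.sFinite
  set J := fun p : EuclideanSpace ℝ (Fin n) × EuclideanSpace ℝ (Fin n) => levyIntegrand p.1 p.2
  have hlarge : IntegrableOn J (Metric.closedBall 0 1 ×ˢ {x | 1 < ‖x‖})
      ((stableLevyMeasure _ β).prod ν) :=
    (integrableOn_prod_levyIntegrand_one_lt_norm hβ h).mono_set
      (Set.prod_mono_left (Set.subset_univ _))
  have hJ : Integrable J (((stableLevyMeasure _ β).restrict (Metric.closedBall 0 1)).prod ν) := by
    rw [← Measure.restrict_univ (μ := ν), Measure.prod_restrict]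
    refine ((hν.integrableOn_prod_levyIntegrand_norm_le_one hβ).union hlarge).mono_set ?_
    rw [← Set.prod_union]
    exact Set.prod_mono_right fun x _ => le_or_gt ‖x‖ 1
  exact hJ.integral_prod_left

theorem integrableOn_levyExponent (hν : IsLevyMeasure ν) (b : EuclideanSpace ℝ (Fin n))
    (Q : Matrix (Fin n) (Fin n) ℝ) (hβ : β ∈ Set.Ioo (0 : ℝ) 1)
    (h : IntegrableOn (fun x => ‖x‖ ^ β) {x | 1 < ‖x‖} ν) :
    IntegrableOn (levyExponent b Q ν) (Metric.closedBall 0 1) (stableLevyMeasure _ β) := by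
  have hdrift := integrableOn_inner_stableLevyMeasure hβ (continuous_const (y := b))
  have hgauss : IntegrableOn (fun ξ : EuclideanSpace ℝ (Fin n) => ξ.ofLp ⬝ᵥ Q.mulVec ξ.ofLp)
      (Metric.closedBall 0 1) (stableLevyMeasure _ β) := by
    simpa [EuclideanSpace.inner_eq_star_dotProduct] using
      integrableOn_inner_stableLevyMeasure hβ (Matrix.toEuclideanCLM (𝕜 := ℝ) Q).continuous
  exact ((hdrift.ofReal.const_mul _).add (hgauss.ofReal.const_mul _)).add
    (hν.integrableOn_integral_levyIntegrand hβ h)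

end IsLevyMeasure

theorem integrableOn_div_norm_rpow_iff {n : ℕ} {β : ℝ}
    {f : EuclideanSpace ℝ (Fin n) → ℝ} :
    IntegrableOn (fun ξ => f ξ / ‖ξ‖ ^ ((n : ℝ) + β)) {ξ | ‖ξ‖ ≤ 1} volume ↔
      IntegrableOn f (Metric.closedBall 0 1) (stableLevyMeasure _ β) := by
  have hball : {ξ : EuclideanSpace ℝ (Fin n) | ‖ξ‖ ≤ 1} = Metric.closedBall 0 1 := by
    ext ξ
    simp
  rw [integrableOn_stableLevyMeasure_iff Metric.isClosed_closedBall.measurableSet, hball]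
  simp_rw [finrank_euclideanSpace_fin, Real.rpow_neg (norm_nonneg _), smul_eq_mul,
    inv_mul_eq_div]

theorem lemma2p2_general {n : ℕ} {b : EuclideanSpace ℝ (Fin n)} {Q : Matrix (Fin n) (Fin n) ℝ}
    {μ ν : Measure (EuclideanSpace ℝ (Fin n))} [IsProbabilityMeasure μ] (hQ : Q.PosSemidef)
    (hν : IsLevyMeasure ν) {t : ℝ} (ht : 0 < t)
    (hμ : ∀ ξ, charFun μ ξ = Complex.exp (-t * levyExponent b Q ν ξ))
    {β : ℝ} (hβ : β ∈ Set.Ioo (0 : ℝ) 1) :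
    List.TFAE [
      Integrable (fun x => ‖x‖ ^ β) μ,
      IntegrableOn (fun x => ‖x‖ ^ β) {x | 1 < ‖x‖} ν,
      IntegrableOn (fun ξ => (levyExponent b Q ν ξ).re / ‖ξ‖ ^ ((n : ℝ) + β))
        {ξ | ‖ξ‖ ≤ 1} volume,
      IntegrableOn (fun ξ => ‖levyExponent b Q ν ξ‖ / ‖ξ‖ ^ ((n : ℝ) + β))
        {ξ | ‖ξ‖ ≤ 1} volume] := by
  have hΨ := hν.measurable_levyExponent b Q
  have hre : ∀ ξ ∈ Metric.closedBall 0 1, 0 ≤ (t * levyExponent b Q ν ξ).re := fun ξ hξ => by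
    rw [Complex.re_ofReal_mul]
    exact mul_nonneg ht.le (hν.re_levyExponent_nonneg b hQ (mem_closedBall_zero_iff.1 hξ))
  simp_rw [neg_mul] at hμ
  have hnorm : IntegrableOn (fun ξ => ‖levyExponent b Q ν ξ‖) (Metric.closedBall 0 1)
      (stableLevyMeasure _ β) ↔ _ := integrable_norm_iff hΨ.aestronglyMeasurable
  rw [integrableOn_div_norm_rpow_iff, integrableOn_div_norm_rpow_iff, hnorm]
  tfae_have 1 → 3 := fun h => by
    have hcont : Continuous (charFun μ) := continuous_charFun
    have hint := integrable_one_sub_charFun hβ h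
    simp_rw [funext hμ] at hcont hint
    have htre := integrableOn_re_of_integrableOn_one_sub_exp_neg (isCompact_closedBall 0 1) hre
      (hΨ.const_mul _).aestronglyMeasurable hcont.continuousOn hint.integrableOn
    simpa [IntegrableOn, integrable_const_mul_iff, ht.ne'] using htre
  tfae_have 3 → 2 :=
    hν.integrableOn_norm_rpow_of_integrableOn_re_levyExponent hQ hβ.1.le
  tfae_have 2 → 4 := hν.integrableOn_levyExponent b Q hβ
  tfae_have 4 → 3 := Integrable.re
  tfae_have 4 → 1 := fun h => by
    refine integrable_norm_rpow_of_integrableOn_one_sub_charFun hβ.1.le ?_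
    simp_rw [hμ]
    exact integrableOn_one_sub_exp_neg Metric.isClosed_closedBall.measurableSet hre
      (h.const_mul _)
  tfae_finish

theorem IsCharacteristicTriplet.charFun_map {Ω : Type*} [MeasurableSpace Ω] {P : Measure Ω} {n : ℕ}
    {X : ℝ≥0 → Ω → EuclideanSpace ℝ (Fin n)} {b : EuclideanSpace ℝ (Fin n)}
    {Q : Matrix (Fin n) (Fin n) ℝ} {ν : Measure (EuclideanSpace ℝ (Fin n))}
    (hΨ : IsCharacteristicTriplet X P b Q ν) {t : ℝ≥0} (ht : AEMeasurable (X t) P)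
    (ξ : EuclideanSpace ℝ (Fin n)) :
    charFun (P.map (X t)) ξ = Complex.exp (-(t : ℝ) * levyExponent b Q ν ξ) := by
  rw [charFun_apply, integral_map ht (Continuous.aestronglyMeasurable (by fun_prop)),
    ← hΨ.charFun_eq]
  simp_rw [real_inner_comm ξ, mul_comm Complex.I]

theorem lemma2p2 {Ω : Type*} [MeasurableSpace Ω] (P : Measure Ω) [IsProbabilityMeasure P] (n : ℕ)
    (X : ℝ≥0 → Ω → EuclideanSpace ℝ (Fin n)) (hX : IsLevyProcess X P)
    (b : EuclideanSpace ℝ (Fin n)) (Q : Matrix (Fin n) (Fin n) ℝ)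
    (ν : Measure (EuclideanSpace ℝ (Fin n))) (hΨ : IsCharacteristicTriplet X P b Q ν)
    (β₀ : ℝ) (hβ₀ : β₀ ∈ Set.Ioo (0 : ℝ) 1) (t : ℝ≥0) (ht : 0 < t) :
    List.TFAE [
      Integrable (fun ω => ‖X t ω‖ ^ β₀) P,
      IntegrableOn (fun x => ‖x‖ ^ β₀) {x | 1 < ‖x‖} ν,
      IntegrableOn (fun ξ => (levyExponent b Q ν ξ).re / ‖ξ‖ ^ ((n : ℝ) + β₀))
        {ξ | ‖ξ‖ ≤ 1} volume,
      IntegrableOn (fun ξ => ‖levyExponent b Q ν ξ‖ / ‖ξ‖ ^ ((n : ℝ) + β₀))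
        {ξ | ‖ξ‖ ≤ 1} volume] := by
  have hXt : AEMeasurable (X t) P := (hX.measurable t).aemeasurable
  have := Measure.isProbabilityMeasure_map hXt
  have h := lemma2p2_general hΨ.posSemidef hΨ.levyMeasure ht (hΨ.charFun_map hXt) hβ₀
  rwa [integrable_map_measure (Measurable.aestronglyMeasurable (by fun_prop)) hXt] at h
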